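/- **Proposition (Woodruff's conjecture).** A *caret* of a finite rooted (ordered) binary tree is an internal vertex together with the two edges to its left and right children; a tree with $n$ carets has $n+1$ leaves, which are numbered consecutively from left to right. An *$n$-caret tree pair* ($n\ge 1$) is an ordered pair $(S,T)$ of rooted binary trees with $n$ carets each. A tree pair with $n\ge 2$ is *unreduced* if there is a $k$ such that each of $S$ and $T$ contains a caret whose two children are the leaves numbered $k$ and $k+1$; every tree pair that is not unreduced is *reduced* (in particular the unique $1$-caret pair is reduced). Let $r_n$ be the number of reduced $n$-caret tree pairs. Then there is a constant $A>0$ such that, with $\mu = 8+4\sqrt3$, $$r_n \sim A\,\frac{\mu^n}{n^3}, \qquad\text{that is,}\qquad \lim_{n\to\infty} \frac{r_n}{A\,\mu^n/n^3} = 1 .$$ -/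

import Mathlib

/-- The positions of the exposed carets of a rooted binary tree. The carets are the internal nodes,
the leaves (the `nil`s) are numbered `0, 1, 2, …` from left to right, and `k` belongs to
`exposedCarets t` iff some caret of `t` has the leaves numbered `k` and `k + 1` as its children. -/
def exposedCarets : BinaryTree Unit → Finset ℕ
  | .nil => ∅
  | .node _ l r =>
      (if l = .nil ∧ r = .nil then {0} else ∅) ∪ exposedCarets l ∪
        (exposedCarets r).image (fun k => l.numLeaves + k)

/-- A pair of trees, each with at least two carets, is unreduced if, for some `k`, each of the
two trees has a caret with leaves numbered `k` and `k + 1`. -/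
def IsUnreducedPair (p : BinaryTree Unit × BinaryTree Unit) : Prop :=
  2 ≤ p.1.numNodes ∧ 2 ≤ p.2.numNodes ∧ ∃ k, k ∈ exposedCarets p.1 ∧ k ∈ exposedCarets p.2

/-- The reduced tree pairs with `n` carets in each tree. Tree pairs are required to be nonempty. -/
def reducedTreePairs (n : ℕ) : Set (BinaryTree Unit × BinaryTree Unit) :=
  {p | 1 ≤ n ∧ p.1.numNodes = n ∧ p.2.numNodes = n ∧ ¬ IsUnreducedPair p}

/-- The number `r_n` of reduced tree pairs with `n` carets in each tree. -/
noncomputable def numReducedTreePairs (n : ℕ) : ℕ := (reducedTreePairs n).ncard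

/-! ### Grafting a caret onto a leaf -/

open BinaryTree

/-! Pairs are sieved by the position of their common exposed carets. Pruning a common exposed caret
at `i` from both trees is a bijection, and exposed carets never occupy adjacent positions. So the
number s(n, i) of n-caret pairs without a common exposed caret below i satisfies s(n+1, i+1) =
s(n+1, i) - s(n, i-1) for i ≤ n (`card_sievedPairs_succ`), starting from s(n, 0) = catalan(n)².

These squares are the moments of a probability measure ν on [0, 16], so the recurrence turns r_n
into ∫ p_n dν, where p_{n+2} = t p_{n+1} - t p_n (`numReducedTreePairs_eq_integral`).

Let λ(t) be the larger root of x² - t x + t. Near t = 16 the kernel p_n(t) is close to K λ(t)^n,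
with λ(16) = 8 + 4√3; away from 16 it is exponentially smaller. Since λ(t)/λ(16) behaves like
(t/16)^κ with κ = 16 λ'(16)/λ(16), the normalized integral is squeezed between multiples of moments
of order about κn (`exists_sieveKernel_squeeze`). Those are catalan(k)²/16^k ~ 1/(π k³) with k ≈ κn,
which gives A = K/(π κ³). -/

/-- Replace the leaf numbered `k` of a tree by a caret. -/
def graftCaret : ℕ → BinaryTree Unit → BinaryTree Unit
  | _, .nil => .node () .nil .nil
  | k, .node u l r =>
      if k < l.numLeaves then .node u (graftCaret k l) r
      else .node u l (graftCaret (k - l.numLeaves) r)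

/-- Replace the exposed caret with leaves numbered `k` and `k + 1` by a leaf. -/
def pruneCaret : ℕ → BinaryTree Unit → BinaryTree Unit
  | _, .nil => .nil
  | k, .node u l r =>
      if l = .nil ∧ r = .nil then .nil
      else if k + 1 < l.numLeaves then .node u (pruneCaret k l) r
      else .node u l (pruneCaret (k - l.numLeaves) r)

theorem numNodes_graftCaret (k : ℕ) (t : BinaryTree Unit) :
    (graftCaret k t).numNodes = t.numNodes + 1 := by
  induction t generalizing k with
  | nil => rfl
  | node u l r ihl ihr =>
    unfold graftCaret
    split_ifs
    · simp only [numNodes, ihl]; omega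
    · simp only [numNodes, ihr]; omega

theorem numLeaves_graftCaret (k : ℕ) (t : BinaryTree Unit) :
    (graftCaret k t).numLeaves = t.numLeaves + 1 := by
  rw [numLeaves_eq_numNodes_succ, numLeaves_eq_numNodes_succ, numNodes_graftCaret]

theorem graftCaret_ne_nil (k : ℕ) (t : BinaryTree Unit) : graftCaret k t ≠ .nil := by
  intro h
  have := numNodes_graftCaret k t
  rw [h] at this
  simp at this

theorem mem_exposedCarets_node {k : ℕ} {u : Unit} {l r : BinaryTree Unit} :
    k ∈ exposedCarets (.node u l r) ↔
      (l = .nil ∧ r = .nil ∧ k = 0) ∨ k ∈ exposedCarets l ∨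
        ∃ j ∈ exposedCarets r, l.numLeaves + j = k := by
  rw [exposedCarets]
  split_ifs with h
  · simp [h, exposedCarets]
  · simp only [Finset.empty_union, Finset.mem_union, Finset.mem_image]
    tauto

theorem not_mem_exposedCarets_nil {k : ℕ} : k ∉ exposedCarets .nil := by
  simp [exposedCarets]

theorem succ_lt_numLeaves_of_mem_exposedCarets {t : BinaryTree Unit} {k : ℕ}
    (h : k ∈ exposedCarets t) : k + 1 < t.numLeaves := by
  induction t generalizing k with
  | nil => exact absurd h not_mem_exposedCarets_nil
  | node u l r ihl ihr =>
    have hl := l.numLeaves_pos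
    have hr := r.numLeaves_pos
    simp only [numLeaves]
    rcases mem_exposedCarets_node.1 h with ⟨-, -, rfl⟩ | hk | ⟨j, hj, rfl⟩
    · omega
    · have := ihl hk; omega
    · have := ihr hj; omega

/-- The leaf `k + 1` has only one parent. This is why the sieve recurrence lowers the position bound
to `i - 1`. -/
theorem succ_not_mem_exposedCarets {t : BinaryTree Unit} {k : ℕ}
    (h : k ∈ exposedCarets t) : k + 1 ∉ exposedCarets t := by
  induction t generalizing k with
  | nil => exact not_mem_exposedCarets_nil
  | node u l r ihl ihr =>
    intro h'
    rcases mem_exposedCarets_node.1 h with ⟨rfl, rfl, rfl⟩ | h | ⟨j, hj, rfl⟩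
    · simpa using succ_lt_numLeaves_of_mem_exposedCarets h'
    · have hk := succ_lt_numLeaves_of_mem_exposedCarets h
      rcases mem_exposedCarets_node.1 h' with ⟨-, -, h0⟩ | h' | ⟨j, h', hj⟩
      · omega
      · exact ihl h h'
      · omega
    · rcases mem_exposedCarets_node.1 h' with ⟨-, -, h0⟩ | h' | ⟨i, h', hi⟩
      · omega
      · have := succ_lt_numLeaves_of_mem_exposedCarets h'; omega
      · obtain rfl : i = j + 1 := by omega
        exact ihr hj h'

theorem pruneCaret_graftCaret {t : BinaryTree Unit} {k : ℕ} (hk : k < t.numLeaves) :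
    pruneCaret k (graftCaret k t) = t := by
  induction t generalizing k with
  | nil => simp [graftCaret, pruneCaret]
  | node u l r ihl ihr =>
    simp only [numLeaves] at hk
    unfold graftCaret
    split_ifs with h
    · simp [pruneCaret, graftCaret_ne_nil, numLeaves_graftCaret, h, ihl h]
    · have h' : ¬ k + 1 < l.numLeaves := by omega
      simp [pruneCaret, graftCaret_ne_nil, h', ihr (show k - l.numLeaves < r.numLeaves by omega)]

theorem exists_graftCaret_eq {t : BinaryTree Unit} {k : ℕ} (hk : k ∈ exposedCarets t) :
    ∃ s, graftCaret k s = t := by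
  induction t generalizing k with
  | nil => exact absurd hk not_mem_exposedCarets_nil
  | node u l r ihl ihr =>
    rcases mem_exposedCarets_node.1 hk with ⟨rfl, rfl, rfl⟩ | h | ⟨j, h, rfl⟩
    · exact ⟨.nil, rfl⟩
    · obtain ⟨s, rfl⟩ := ihl h
      have := succ_lt_numLeaves_of_mem_exposedCarets h
      rw [numLeaves_graftCaret] at this
      exact ⟨.node u s r, by rw [graftCaret, if_pos (by omega)]⟩
    · obtain ⟨s, rfl⟩ := ihr h
      exact ⟨.node u l s, by rw [graftCaret, if_neg (by omega), Nat.add_sub_cancel_left]⟩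

theorem mem_exposedCarets_graftCaret {t : BinaryTree Unit} {k : ℕ} (hk : k < t.numLeaves) :
    k ∈ exposedCarets (graftCaret k t) := by
  induction t generalizing k with
  | nil => simpa [graftCaret, exposedCarets] using hk
  | node u l r ihl ihr =>
    simp only [numLeaves] at hk
    unfold graftCaret
    split_ifs with h
    · exact mem_exposedCarets_node.2 (.inr (.inl (ihl h)))
    · exact mem_exposedCarets_node.2
        (.inr (.inr ⟨k - l.numLeaves, ihr (by omega), by omega⟩))

/-- Grafting a caret at the leaf `k` does not affect the exposed carets on the left of it. -/
theorem mem_exposedCarets_graftCaret_iff {t : BinaryTree Unit} {j k : ℕ} (hk : k < t.numLeaves)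
    (hjk : j + 1 < k) : j ∈ exposedCarets (graftCaret k t) ↔ j ∈ exposedCarets t := by
  induction t generalizing j k with
  | nil => simp only [numLeaves] at hk; omega
  | node u l r ihl ihr =>
    simp only [numLeaves] at hk
    unfold graftCaret
    split_ifs with h
    · simp only [mem_exposedCarets_node, graftCaret_ne_nil, ihl h hjk, numLeaves_graftCaret]
      constructor
      · rintro (⟨h', -⟩ | h' | ⟨i, -, hi⟩)
        · exact h'.elim
        · exact .inr (.inl h')
        · omega
      · rintro (⟨rfl, -⟩ | h' | ⟨i, -, hi⟩)
        · simp only [numLeaves] at h; omega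
        · exact .inr (.inl h')
        · omega
    · simp only [mem_exposedCarets_node, graftCaret_ne_nil]
      have key : ∀ i, l.numLeaves + i = j →
          (i ∈ exposedCarets (graftCaret (k - l.numLeaves) r) ↔ i ∈ exposedCarets r) :=
        fun i hi => ihr (by omega) (by omega)
      constructor
      · rintro (⟨-, h', -⟩ | h' | ⟨i, hi, hij⟩)
        · exact h'.elim
        · exact .inr (.inl h')
        · exact .inr (.inr ⟨i, (key i hij).1 hi, hij⟩)
      · rintro (⟨rfl, rfl, -⟩ | h' | ⟨i, hi, hij⟩)
        · simp only [numLeaves] at hk; omega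
        · exact .inr (.inl h')
        · exact .inr (.inr ⟨i, (key i hij).2 hi, hij⟩)

/-! ### Sieving tree pairs by the position of their common exposed carets -/

/-- The pairs of trees with `n` carets each without common exposed caret at a position below
`i`. -/
def sievedPairs (n i : ℕ) : Finset (BinaryTree Unit × BinaryTree Unit) :=
  (treesOfNumNodesEq n ×ˢ treesOfNumNodesEq n).filter
    fun p => ∀ k < i, ¬ (k ∈ exposedCarets p.1 ∧ k ∈ exposedCarets p.2)

theorem mem_sievedPairs {n i : ℕ} {p : BinaryTree Unit × BinaryTree Unit} :
    p ∈ sievedPairs n i ↔ (p.1.numNodes = n ∧ p.2.numNodes = n) ∧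
      ∀ k < i, ¬ (k ∈ exposedCarets p.1 ∧ k ∈ exposedCarets p.2) := by
  simp [sievedPairs, mem_treesOfNumNodesEq]

theorem card_sievedPairs_zero (n : ℕ) : (sievedPairs n 0).card = catalan n ^ 2 := by
  simp [sievedPairs, treesOfNumNodesEq_card_eq_catalan, sq]

/-- Grafting a caret at leaf `i` of both trees is the bijection. It preserves exposure at positions
below `i - 1` and excludes it at `i - 1`, so the smaller pair is unconstrained there. For `i = 0`
the truncated `i - 1 = 0` is the right value. -/
theorem card_filter_common_exposedCaret {n i : ℕ} (hi : i ≤ n) :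
    ((sievedPairs (n + 1) i).filter
      fun p => i ∈ exposedCarets p.1 ∧ i ∈ exposedCarets p.2).card =
      (sievedPairs n (i - 1)).card := by
  have hleaves : ∀ t : BinaryTree Unit, t.numNodes = n → i < t.numLeaves := fun t ht => by
    rw [numLeaves_eq_numNodes_succ]; omega
  symm
  refine Finset.card_bij (fun p _ => (graftCaret i p.1, graftCaret i p.2)) ?_ ?_ ?_
  · rintro ⟨s, t⟩ h
    obtain ⟨⟨hs, ht⟩, h⟩ := mem_sievedPairs.1 h
    simp only at hs ht h
    have hs' := hleaves s hs
    have ht' := hleaves t ht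
    rw [Finset.mem_filter, mem_sievedPairs]
    refine ⟨⟨⟨by simp [numNodes_graftCaret, hs], by simp [numNodes_graftCaret, ht]⟩, ?_⟩,
      mem_exposedCarets_graftCaret hs', mem_exposedCarets_graftCaret ht'⟩
    rintro k hk ⟨h1, h2⟩
    rcases Nat.lt_or_ge (k + 1) i with hki | hki
    · exact h k (by omega) ⟨(mem_exposedCarets_graftCaret_iff hs' hki).1 h1,
        (mem_exposedCarets_graftCaret_iff ht' hki).1 h2⟩
    · obtain rfl : i = k + 1 := by omega
      exact succ_not_mem_exposedCarets h1 (mem_exposedCarets_graftCaret hs')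
  · rintro ⟨s, t⟩ h ⟨s', t'⟩ h' heq
    obtain ⟨⟨hs, ht⟩, -⟩ := mem_sievedPairs.1 h
    obtain ⟨⟨hs', ht'⟩, -⟩ := mem_sievedPairs.1 h'
    obtain ⟨e1, e2⟩ := Prod.mk.inj heq
    have e1 := congrArg (pruneCaret i) e1
    have e2 := congrArg (pruneCaret i) e2
    rw [pruneCaret_graftCaret (hleaves s hs), pruneCaret_graftCaret (hleaves s' hs')] at e1
    rw [pruneCaret_graftCaret (hleaves t ht), pruneCaret_graftCaret (hleaves t' ht')] at e2
    rw [e1, e2]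
  · rintro ⟨s, t⟩ h
    obtain ⟨h, his, hit⟩ := Finset.mem_filter.1 h
    obtain ⟨⟨hs, ht⟩, h⟩ := mem_sievedPairs.1 h
    obtain ⟨s, rfl⟩ := exists_graftCaret_eq his
    obtain ⟨t, rfl⟩ := exists_graftCaret_eq hit
    simp only [numNodes_graftCaret, Nat.add_right_cancel_iff] at hs ht
    refine ⟨(s, t), mem_sievedPairs.2 ⟨⟨hs, ht⟩, ?_⟩, rfl⟩
    rintro k hk ⟨h1, h2⟩
    exact h k (by omega) ⟨(mem_exposedCarets_graftCaret_iff (hleaves s hs) (by omega)).2 h1,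
      (mem_exposedCarets_graftCaret_iff (hleaves t ht) (by omega)).2 h2⟩

theorem card_sievedPairs_succ {n i : ℕ} (hi : i ≤ n) :
    (sievedPairs (n + 1) (i + 1)).card + (sievedPairs n (i - 1)).card =
      (sievedPairs (n + 1) i).card := by
  rw [← card_filter_common_exposedCaret hi, add_comm, ← Finset.card_filter_add_card_filter_not
    (s := sievedPairs (n + 1) i) fun p => i ∈ exposedCarets p.1 ∧ i ∈ exposedCarets p.2]
  congr 2
  ext p
  simp only [Finset.mem_filter, mem_sievedPairs, Nat.lt_succ_iff_lt_or_eq]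
  constructor
  · rintro ⟨h, h'⟩
    exact ⟨⟨h, fun k hk => h' k (.inl hk)⟩, h' i (.inr rfl)⟩
  · rintro ⟨⟨h, h'⟩, hi⟩
    refine ⟨h, fun k hk => ?_⟩
    rcases hk with hk | rfl
    · exact h' k hk
    · exact hi

/-- With `n + 1` leaves, every exposed position is below `n`. For `n = 1` this fails: the only pair
is reduced by convention but has a common exposed caret. -/
theorem numReducedTreePairs_eq_card_sievedPairs {n : ℕ} (hn : 2 ≤ n) :
    numReducedTreePairs n = (sievedPairs n n).card := by
  rw [numReducedTreePairs, ← Set.ncard_coe_finset]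
  congr 1
  ext p
  simp only [reducedTreePairs, IsUnreducedPair, Set.mem_ofPred_eq, Finset.mem_coe, mem_sievedPairs]
  constructor
  · rintro ⟨-, h1, h2, h⟩
    exact ⟨⟨h1, h2⟩, fun k _ hk => h ⟨by omega, by omega, k, hk⟩⟩
  · rintro ⟨⟨h1, h2⟩, h⟩
    refine ⟨by omega, h1, h2, ?_⟩
    rintro ⟨-, -, k, hk⟩
    have := succ_lt_numLeaves_of_mem_exposedCarets hk.1
    rw [numLeaves_eq_numNodes_succ] at this
    exact h k (by omega) hk


/-! ### Squared Catalan numbers as moments -/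

open MeasureTheory Filter Topology Real

theorem integral_sin_pow_mul_cos_sq (k : ℕ) :
    ∫ x in (0 : ℝ)..π, (4 * sin x ^ 2) ^ k * (2 / π * cos x ^ 2) = (catalan k : ℝ) := by
  have hI : ∀ j : ℕ, IntervalIntegrable (fun x : ℝ => sin x ^ (2 * j)) volume 0 π := fun j =>
    (by fun_prop : Continuous fun x : ℝ => sin x ^ (2 * j)).intervalIntegrable _ _
  have hmom : ∀ j : ℕ, 4 ^ j * ∫ x in (0 : ℝ)..π, sin x ^ (2 * j) = π * Nat.centralBinom j := by
    intro j
    rw [integral_sin_pow_even]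
    induction j with
    | zero => simp
    | succ j ih =>
      have h : ((j : ℝ) + 1) * Nat.centralBinom (j + 1) = 2 * (2 * j + 1) * Nat.centralBinom j := by
        exact_mod_cast Nat.succ_mul_centralBinom_succ j
      rw [Finset.prod_range_succ]
      have hj : (j : ℝ) + 1 ≠ 0 := by positivity
      apply mul_left_cancel₀ hj
      have e : ((j : ℝ) + 1) * (π * Nat.centralBinom (j + 1)) =
          2 * (2 * j + 1) * (π * Nat.centralBinom j) := by linear_combination π * h
      rw [e, ← ih]
      field_simp
      ring
  have hcat : ((k : ℝ) + 1) * catalan k = Nat.centralBinom k := by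
    exact_mod_cast succ_mul_catalan_eq_centralBinom k
  have hsucc : ((k : ℝ) + 1) * Nat.centralBinom (k + 1) = 2 * (2 * k + 1) * Nat.centralBinom k := by
    exact_mod_cast Nat.succ_mul_centralBinom_succ k
  -- Writing cos² = 1 - sin² reduces the integral to two consecutive Wallis integrals.
  have e : ∀ x : ℝ, (4 * sin x ^ 2) ^ k * (2 / π * cos x ^ 2) =
      2 / π * 4 ^ k * (sin x ^ (2 * k) - sin x ^ (2 * (k + 1))) := by
    intro x
    rw [cos_sq', mul_pow, ← pow_mul]
    ring
  simp_rw [e]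
  rw [intervalIntegral.integral_const_mul, intervalIntegral.integral_sub (hI _) (hI _)]
  have h0 := hmom k
  have h1 := hmom (k + 1)
  have hk : (k : ℝ) + 1 ≠ 0 := by positivity
  have hpi := pi_ne_zero
  apply mul_left_cancel₀ hk
  rw [hcat]
  set a := ∫ x in (0 : ℝ)..π, sin x ^ (2 * k)
  set b := ∫ x in (0 : ℝ)..π, sin x ^ (2 * (k + 1))
  field_simp
  rw [pow_succ] at h1
  linear_combination 2 * ((k : ℝ) + 1) * h0 - ((k : ℝ) + 1) / 2 * h1 - π / 2 * hsucc

/-- The Catalan numbers are the moments of a finite measure on `[0, 4]`. -/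
theorem exists_measure_moments_catalan :
    ∃ m : Measure ℝ, IsFiniteMeasure m ∧ (∀ᵐ t ∂m, t ∈ Set.Icc (0 : ℝ) 4) ∧
      ∀ k : ℕ, ∫ t, t ^ k ∂m = catalan k := by
  set w : ℝ → ℝ := fun x => 2 / π * cos x ^ 2 with hw
  have hwc : Continuous w := by fun_prop
  have hw0 : ∀ x, 0 ≤ w x := fun x => by have := pi_pos; positivity
  set m₀ : Measure ℝ := (volume.restrict (Set.Ioc 0 π)).withDensity fun x => ENNReal.ofReal (w x)
    with hm₀
  have hg : Measurable fun x : ℝ => 4 * sin x ^ 2 := by fun_prop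
  have hfin : IsFiniteMeasure m₀ := by
    apply isFiniteMeasure_withDensity_ofReal
    exact (hwc.integrableOn_Ioc).2
  refine ⟨m₀.map fun x => 4 * sin x ^ 2, inferInstance, ?_, fun k => ?_⟩
  · refine (ae_map_iff (p := (· ∈ Set.Icc (0 : ℝ) 4)) hg.aemeasurable measurableSet_Icc).2 ?_
    refine .of_forall fun x => ⟨by positivity, ?_⟩
    nlinarith [sin_sq_le_one x]
  · rw [integral_map hg.aemeasurable (by fun_prop), hm₀,
      integral_withDensity_eq_integral_toReal_smul (by fun_prop) (by simp),
      ← integral_sin_pow_mul_cos_sq, intervalIntegral.integral_of_le pi_pos.le]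
    refine integral_congr_ae (.of_forall fun x => ?_)
    simp only [ENNReal.toReal_ofReal (hw0 x), smul_eq_mul]
    exact mul_comm _ _

/-- The squares of the Catalan numbers are the moments of a probability measure on `[0, 16]`. -/
theorem exists_measure_moments_catalan_sq :
    ∃ ν : Measure ℝ, IsProbabilityMeasure ν ∧ (∀ᵐ t ∂ν, t ∈ Set.Icc (0 : ℝ) 16) ∧
      ∀ k : ℕ, ∫ t, t ^ k ∂ν = (catalan k : ℝ) ^ 2 := by
  obtain ⟨m, hm, hsupp, hmom⟩ := exists_measure_moments_catalan
  have hmul : Measurable fun p : ℝ × ℝ => p.1 * p.2 := by fun_prop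
  have hk : ∀ k : ℕ, ∫ t, t ^ k ∂((m.prod m).map fun p => p.1 * p.2) = (catalan k : ℝ) ^ 2 := by
    intro k
    rw [integral_map hmul.aemeasurable (by fun_prop)]
    simp_rw [mul_pow]
    rw [integral_prod_mul (fun x : ℝ => x ^ k) (fun x : ℝ => x ^ k), hmom, sq]
  -- The law of a product of two independent copies: moments multiply. Total mass one is the zeroth
  -- moment.
  refine ⟨(m.prod m).map fun p => p.1 * p.2, ?_, ?_, hk⟩
  · have h := hk 0
    simp only [pow_zero, integral_const, smul_eq_mul, mul_one, catalan_zero, Nat.cast_one,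
      one_pow, Measure.real] at h
    exact ⟨(ENNReal.toReal_eq_one_iff _).1 h⟩
  · refine (ae_map_iff (p := (· ∈ Set.Icc (0 : ℝ) 16)) hmul.aemeasurable measurableSet_Icc).2 ?_
    have h1 : ∀ᵐ p ∂m.prod m, p.1 ∈ Set.Icc (0 : ℝ) 4 := Measure.quasiMeasurePreserving_fst.ae hsupp
    have h2 : ∀ᵐ p ∂m.prod m, p.2 ∈ Set.Icc (0 : ℝ) 4 := Measure.quasiMeasurePreserving_snd.ae hsupp
    filter_upwards [h1, h2] with p hp hq
    exact ⟨mul_nonneg hp.1 hq.1, by nlinarith [hp.1, hp.2, hq.1, hq.2]⟩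

theorem integrable_of_continuous_of_ae_mem_Icc {ν : Measure ℝ} [IsFiniteMeasure ν] {a b : ℝ}
    (hν : ∀ᵐ t ∂ν, t ∈ Set.Icc a b) {f : ℝ → ℝ} (hf : Continuous f) : Integrable f ν := by
  obtain ⟨C, hC⟩ := isCompact_Icc.exists_bound_of_continuousOn (s := Set.Icc a b) hf.continuousOn
  exact Integrable.of_bound hf.aestronglyMeasurable C (hν.mono hC)

/-- Wallis' formula gives `c_k ^ 2 ∼ 16 ^ k / (π k ^ 3)` for the Catalan numbers `c_k`. -/
theorem tendsto_catalan_sq :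
    Tendsto (fun k : ℕ => (k : ℝ) ^ 3 * ((catalan k : ℝ) ^ 2 / 16 ^ k)) atTop (𝓝 (1 / π)) := by
  have key : ∀ k : ℕ, (catalan k : ℝ) ^ 2 / 16 ^ k =
      1 / (Wallis.W k * (2 * k + 1) * (k + 1) ^ 2) := by
    intro k
    have hcat : ((k : ℝ) + 1) * catalan k = Nat.centralBinom k := by
      exact_mod_cast succ_mul_catalan_eq_centralBinom k
    have hb : (Nat.centralBinom k : ℝ) = (2 * k).factorial / (k.factorial * k.factorial) := by
      rw [Nat.centralBinom_eq_two_mul_choose, Nat.cast_choose ℝ (by omega : k ≤ 2 * k)]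
      congr 4
      omega
    have hc : (catalan k : ℝ) = (2 * k).factorial / (k.factorial * k.factorial) / (k + 1) := by
      rw [← hb, ← hcat]
      field_simp
    rw [hc, Wallis.W_eq_factorial_ratio, pow_mul]
    have h1 : (k.factorial : ℝ) ≠ 0 := by positivity
    have h2 : ((2 * k).factorial : ℝ) ≠ 0 := by positivity
    norm_num
    field_simp
  have hlim : Tendsto (fun k : ℕ => 1 / (Wallis.W k * ((2 + 1 / (k : ℝ)) * (1 + 1 / (k : ℝ)) ^ 2)))
      atTop (𝓝 (1 / (π / 2 * ((2 + 0) * (1 + 0) ^ 2)))) := by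
    have h0 : Tendsto (fun k : ℕ => 1 / (k : ℝ)) atTop (𝓝 0) := tendsto_one_div_atTop_nhds_zero_nat
    refine tendsto_const_nhds.div (Wallis.tendsto_W_nhds_pi_div_two.mul
      ((h0.const_add 2).mul ((h0.const_add 1).pow 2))) ?_
    have := pi_pos
    positivity
  have e : 1 / (π / 2 * ((2 + 0) * (1 + 0) ^ 2)) = 1 / π := by norm_num
  rw [e] at hlim
  refine hlim.congr' ?_
  filter_upwards [eventually_gt_atTop 0] with k hk
  have hk' : (0 : ℝ) < k := by exact_mod_cast hk
  have hW := Wallis.W_pos k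
  rw [key]
  field_simp

/-! ### The sieve kernel -/

/-- The kernel which counts reduced tree pairs when integrated against the measure with moments
`catalan k ^ 2`. -/
def sieveKernel (t : ℝ) : ℕ → ℝ
  | 0 => 1
  | 1 => t - 1
  | n + 2 => t * sieveKernel t (n + 1) - t * sieveKernel t n

theorem continuous_sieveKernel : ∀ n, Continuous fun t => sieveKernel t n
  | 0 => by simp only [sieveKernel]; fun_prop
  | 1 => by simp only [sieveKernel]; fun_prop
  | n + 2 => by
    have h1 := continuous_sieveKernel n
    have h2 := continuous_sieveKernel (n + 1)
    simp only [sieveKernel]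
    fun_prop

/-- The factor `t ^ m` records the surplus of carets over the sieve bound. Both terms of the sieve
recurrence have surplus `m + 1`, whence the factors `t` in `sieveKernel`. -/
theorem card_sievedPairs_eq_integral {ν : Measure ℝ} [IsProbabilityMeasure ν]
    (hν : ∀ᵐ t ∂ν, t ∈ Set.Icc (0 : ℝ) 16)
    (hmom : ∀ k : ℕ, ∫ t, t ^ k ∂ν = (catalan k : ℝ) ^ 2) :
    ∀ i m : ℕ, ((sievedPairs (m + i) i).card : ℝ) = ∫ t, t ^ m * sieveKernel t i ∂ν
  | 0, m => by simp [sieveKernel, card_sievedPairs_zero, hmom]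
  | 1, m => by
    have h : ((sievedPairs (m + 1) 1).card : ℝ) + (sievedPairs m 0).card =
        (sievedPairs (m + 1) 0).card := by
      exact_mod_cast card_sievedPairs_succ (Nat.zero_le m)
    have e : ∀ t : ℝ, t ^ m * sieveKernel t 1 = t ^ (m + 1) - t ^ m := fun t => by
      simp only [sieveKernel]; ring
    simp_rw [e]
    rw [integral_sub (integrable_of_continuous_of_ae_mem_Icc hν (by fun_prop))
      (integrable_of_continuous_of_ae_mem_Icc hν (by fun_prop)), hmom, hmom]
    simp only [card_sievedPairs_zero, Nat.cast_pow] at h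
    linarith
  | i + 2, m => by
    have h : ((sievedPairs (m + (i + 2)) (i + 2)).card : ℝ) +
        (sievedPairs (m + 1 + i) i).card = (sievedPairs (m + 1 + (i + 1)) (i + 1)).card := by
      have := card_sievedPairs_succ (show i + 1 ≤ m + 1 + i by omega)
      rw [show m + (i + 2) = m + 1 + i + 1 by omega]
      exact_mod_cast this
    have e : ∀ t : ℝ, t ^ m * sieveKernel t (i + 2) =
        t ^ (m + 1) * sieveKernel t (i + 1) - t ^ (m + 1) * sieveKernel t i := fun t => by
      simp only [sieveKernel]; ring
    have hc : ∀ j, Integrable (fun t => t ^ (m + 1) * sieveKernel t j) ν := fun j =>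
      integrable_of_continuous_of_ae_mem_Icc hν
        ((continuous_pow _).mul (continuous_sieveKernel j))
    simp_rw [e]
    rw [integral_sub (hc _) (hc _), ← card_sievedPairs_eq_integral hν hmom (i + 1),
      ← card_sievedPairs_eq_integral hν hmom i]
    linarith

theorem numReducedTreePairs_eq_integral {ν : Measure ℝ} [IsProbabilityMeasure ν]
    (hν : ∀ᵐ t ∂ν, t ∈ Set.Icc (0 : ℝ) 16)
    (hmom : ∀ k : ℕ, ∫ t, t ^ k ∂ν = (catalan k : ℝ) ^ 2) {n : ℕ} (hn : 2 ≤ n) :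
    (numReducedTreePairs n : ℝ) = ∫ t, sieveKernel t n ∂ν := by
  rw [numReducedTreePairs_eq_card_sievedPairs hn]
  simpa using card_sievedPairs_eq_integral hν hmom n 0


/-! ### Solving and bounding the kernel recurrence -/

theorem norm_le_of_linear_recurrence {u : ℕ → ℂ} {a b : ℂ} {ρ : ℝ} (hρ : 1 ≤ ρ) (ha : ‖a‖ ≤ ρ)
    (hb : ‖b‖ ≤ ρ) (h0 : u 0 = 1) (h1 : u 1 = a + b - 1)
    (hrec : ∀ n, u (n + 2) = (a + b) * u (n + 1) - a * b * u n) (n : ℕ) :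
    ‖u n‖ ≤ (1 + 2 * n) * ρ ^ n := by
  -- Reducing to first order avoids division by `a - b`, so the bound survives a double root.
  have hstep : ∀ n, u (n + 1) = a * u n + b ^ n * (b - 1) := by
    intro n
    induction n with
    | zero => rw [h1, h0]; ring
    | succ n ih =>
      rw [hrec, pow_succ]
      linear_combination b * ih
  induction n with
  | zero => simp [h0]
  | succ n ih =>
    have hρn : 0 ≤ ρ ^ n := by positivity
    have hb1 : ‖b - 1‖ ≤ 2 * ρ := (norm_sub_le b 1).trans (by rw [norm_one]; linarith)
    calc ‖u (n + 1)‖ ≤ ‖a‖ * ‖u n‖ + ‖b‖ ^ n * ‖b - 1‖ := by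
          rw [hstep, ← norm_mul, ← norm_pow, ← norm_mul]
          exact norm_add_le _ _
      _ ≤ ρ * ((1 + 2 * n) * ρ ^ n) + ρ ^ n * (2 * ρ) := by gcongr
      _ = (1 + 2 * (n + 1 : ℕ)) * ρ ^ (n + 1) := by push_cast; ring

theorem sub_mul_sieveKernel {a b t : ℝ} (hadd : a + b = t) (hmul : a * b = t) :
    ∀ n, (a - b) * sieveKernel t n = (a - 1) * a ^ n - (b - 1) * b ^ n
  | 0 => by simp [sieveKernel]
  | 1 => by simp only [sieveKernel]; rw [← hadd]; ring
  | n + 2 => by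
    have h1 := sub_mul_sieveKernel hadd hmul (n + 1)
    have h0 := sub_mul_sieveKernel hadd hmul n
    simp only [sieveKernel]
    have ha : a ^ 2 = t * a - t := by linear_combination a * hadd - hmul
    have hb : b ^ 2 = t * b - t := by linear_combination b * hadd - hmul
    rw [pow_add a, pow_add b, ha, hb]
    linear_combination t * h1 - t * h0

/-! ### The dominant root of the kernel -/

/-- The larger root of `x ^ 2 - t * x + t`. -/
noncomputable def dominantRoot (t : ℝ) : ℝ := (t + √(t ^ 2 - 4 * t)) / 2

/-- The amplitude of `dominantRoot t ^ n` in `sieveKernel t n`. -/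
noncomputable def dominantAmplitude (t : ℝ) : ℝ := (dominantRoot t - 1) / √(t ^ 2 - 4 * t)

theorem sqrt_sixteen_sq_sub : √((16 : ℝ) ^ 2 - 4 * 16) = 8 * √3 := by
  rw [show (16 : ℝ) ^ 2 - 4 * 16 = 8 ^ 2 * 3 by norm_num, sqrt_mul (by positivity),
    sqrt_sq (by positivity)]

theorem dominantRoot_sixteen : dominantRoot 16 = 8 + 4 * √3 := by
  rw [dominantRoot, sqrt_sixteen_sq_sub]
  ring

theorem dominantRoot_lt {s t : ℝ} (hs : 4 ≤ s) (hst : s < t) :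
    dominantRoot s < dominantRoot t := by
  have : √(s ^ 2 - 4 * s) ≤ √(t ^ 2 - 4 * t) := sqrt_le_sqrt (by nlinarith)
  unfold dominantRoot
  linarith

theorem dominantRoot_le {s t : ℝ} (hs : 4 ≤ s) (hst : s ≤ t) :
    dominantRoot s ≤ dominantRoot t := by
  rcases hst.eq_or_lt with rfl | h
  · exact le_rfl
  · exact (dominantRoot_lt hs h).le

theorem two_le_dominantRoot {t : ℝ} (ht : 4 ≤ t) : 2 ≤ dominantRoot t := by
  have := sqrt_nonneg (t ^ 2 - 4 * t)
  unfold dominantRoot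
  linarith

theorem dominantRoot_pos {t : ℝ} (ht : 0 < t) : 0 < dominantRoot t := by
  have := sqrt_nonneg (t ^ 2 - 4 * t)
  unfold dominantRoot
  linarith

/-- For `t ≤ 4` the roots are conjugate of modulus `√t ≤ 2`; for `t ≥ 4` they are real and the
larger one increases with `t`. -/
theorem exists_complex_roots {t t₀ : ℝ} (h4 : 4 ≤ t₀) (ht : 0 ≤ t) (htt : t ≤ t₀) :
    ∃ a b : ℂ, a + b = t ∧ a * b = t ∧ ‖a‖ ≤ dominantRoot t₀ ∧ ‖b‖ ≤ dominantRoot t₀ := by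
  rcases le_total t 4 with h | h
  · have hs : 0 ≤ t - t ^ 2 / 4 := by nlinarith
    have hsq : √(t - t ^ 2 / 4) ^ 2 = t - t ^ 2 / 4 := sq_sqrt hs
    have hle : √t ≤ dominantRoot t₀ := by
      refine le_trans ?_ (two_le_dominantRoot h4)
      rw [sqrt_le_left (by norm_num)]
      linarith
    refine ⟨⟨t / 2, √(t - t ^ 2 / 4)⟩, ⟨t / 2, -√(t - t ^ 2 / 4)⟩, ?_, ?_, ?_, ?_⟩
    · apply Complex.ext <;> simp
    · apply Complex.ext
      · simp; linear_combination hsq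
      · simp; ring
    · convert hle using 1
      rw [Complex.norm_def, Complex.normSq_mk]
      congr 1; linear_combination hsq
    · convert hle using 1
      rw [Complex.norm_def, Complex.normSq_mk]
      congr 1; linear_combination hsq
  · have hs : 0 ≤ t ^ 2 - 4 * t := by nlinarith
    have hsq : √(t ^ 2 - 4 * t) ^ 2 = t ^ 2 - 4 * t := sq_sqrt hs
    have hs0 := sqrt_nonneg (t ^ 2 - 4 * t)
    have hle := dominantRoot_le h htt
    have hst : √(t ^ 2 - 4 * t) ≤ t := by
      rw [sqrt_le_left ht]; linarith
    refine ⟨((dominantRoot t : ℝ) : ℂ), ((t - dominantRoot t : ℝ) : ℂ), ?_, ?_, ?_, ?_⟩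
    · push_cast; ring
    · rw [← Complex.ofReal_mul]
      congr 1
      unfold dominantRoot
      linear_combination -hsq / 4
    · rw [Complex.norm_real, norm_eq_abs, abs_of_nonneg (by have := two_le_dominantRoot h; linarith)]
      exact hle
    · rw [Complex.norm_real, norm_eq_abs, abs_le]
      unfold dominantRoot at hle ⊢
      constructor <;> linarith

theorem abs_sieveKernel_le {t t₀ : ℝ} (h4 : 4 ≤ t₀) (ht : 0 ≤ t) (htt : t ≤ t₀) (n : ℕ) :
    |sieveKernel t n| ≤ (1 + 2 * n) * dominantRoot t₀ ^ n := by
  obtain ⟨a, b, hadd, hmul, ha, hb⟩ := exists_complex_roots h4 ht htt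
  have hρ : 1 ≤ dominantRoot t₀ := by linarith [two_le_dominantRoot h4]
  have := norm_le_of_linear_recurrence (u := fun n => (sieveKernel t n : ℂ)) hρ ha hb
    (by simp [sieveKernel]) (by simp [sieveKernel, hadd])
    (fun n => by simp [sieveKernel, hadd, hmul]) n
  rwa [Complex.norm_real, norm_eq_abs] at this

/-- The difference is the contribution of the smaller root, which lies in `[1, 2]`. Requiring `5 ≤
t` keeps the discriminant away from its zero at `4`. -/
theorem abs_sieveKernel_sub_le {t : ℝ} (ht : 5 ≤ t) (n : ℕ) :
    |sieveKernel t n - dominantAmplitude t * dominantRoot t ^ n| ≤ 2 ^ n := by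
  set s := √(t ^ 2 - 4 * t) with hs
  have hsq : s ^ 2 = t ^ 2 - 4 * t := sq_sqrt (by nlinarith)
  have hs1 : 1 ≤ s := by
    rw [hs, one_le_sqrt]; nlinarith
  have hs2 : t - 4 ≤ s := by
    rw [hs]; apply le_sqrt_of_sq_le; nlinarith
  have hst : s ≤ t - 2 := by
    rw [hs, sqrt_le_left (by linarith)]; nlinarith
  have key := sub_mul_sieveKernel (a := (t + s) / 2) (b := (t - s) / 2) (t := t) (by ring)
    (by linear_combination -hsq / 4) n
  rw [show (t + s) / 2 - (t - s) / 2 = s by ring] at key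
  have e : sieveKernel t n - dominantAmplitude t * dominantRoot t ^ n =
      -(((t - s) / 2 - 1) * ((t - s) / 2) ^ n / s) := by
    unfold dominantAmplitude dominantRoot
    rw [← hs]
    field_simp at key ⊢
    linear_combination key
  rw [e, abs_neg, abs_of_nonneg (div_nonneg (mul_nonneg (by linarith)
    (pow_nonneg (by linarith) _)) (by linarith))]
  calc ((t - s) / 2 - 1) * ((t - s) / 2) ^ n / s
      ≤ ((t - s) / 2 - 1) * ((t - s) / 2) ^ n :=
        div_le_self (mul_nonneg (by linarith) (pow_nonneg (by linarith) _)) hs1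
    _ ≤ 1 * 2 ^ n := by
        refine mul_le_mul (by linarith) (pow_le_pow_left₀ (by linarith) (by linarith) _)
          (pow_nonneg (by linarith) _) zero_le_one
    _ = 2 ^ n := one_mul _

/-! ### Power bounds at the dominant singularity -/

/-- A function with positive derivative at `a` stays below its value at `a` just before `a`. -/
theorem eventually_le_of_hasDerivAt_pos {f : ℝ → ℝ} {f' a : ℝ} (hf : HasDerivAt f f' a)
    (hpos : 0 < f') : ∀ᶠ t in 𝓝[≤] a, f t ≤ f a := by
  have h := (hasDerivAt_iff_tendsto_slope.1 hf).eventually (lt_mem_nhds hpos)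
  rw [eventually_nhdsWithin_iff] at h ⊢
  filter_upwards [h] with t ht hta
  rcases (Set.mem_Iic.1 hta).eq_or_lt with rfl | hlt
  · exact le_rfl
  · have := ht hlt.ne
    rw [slope_def_field, div_pos_iff] at this
    rcases this with h' | h' <;> linarith [h'.1, h'.2]

theorem hasDerivAt_log_sub {g : ℝ → ℝ} {g' a : ℝ} (hg : HasDerivAt g g' a) (ha : 0 < a)
    (hga : 0 < g a) (c : ℝ) :
    HasDerivAt (fun t => log (g t) - c * log t) (g' / g a - c * a⁻¹) a :=
  (hg.log hga.ne').sub ((hasDerivAt_log ha.ne').const_mul c)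

/-- After taking logarithms: `log (g t) - c * log t` has positive derivative at `a` when `c` is
below the logarithmic slope `a * g' / g a`. -/
theorem eventually_div_le_rpow {g : ℝ → ℝ} {g' a c : ℝ} (hg : HasDerivAt g g' a) (ha : 0 < a)
    (hga : 0 < g a) (hc : c < a * g' / g a) :
    ∀ᶠ t in 𝓝[≤] a, g t / g a ≤ (t / a) ^ c := by
  have hpos : 0 < g' / g a - c * a⁻¹ := by
    have : c / a < g' / g a := by rwa [div_lt_iff₀ ha, div_mul_eq_mul_div, mul_comm g']
    rw [← div_eq_mul_inv]; linarith
  have h1 := eventually_le_of_hasDerivAt_pos (hasDerivAt_log_sub hg ha hga c) hpos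
  have h2 : ∀ᶠ t in 𝓝[≤] a, 0 < t := nhdsWithin_le_nhds (lt_mem_nhds ha)
  have h3 : ∀ᶠ t in 𝓝[≤] a, 0 < g t :=
    nhdsWithin_le_nhds (hg.continuousAt.eventually (lt_mem_nhds hga))
  filter_upwards [h1, h2, h3] with t h1 h2 h3
  rw [← log_le_log_iff (by positivity) (by positivity), log_rpow (by positivity),
    log_div h3.ne' hga.ne', log_div h2.ne' ha.ne']
  linarith

theorem eventually_rpow_le_div {g : ℝ → ℝ} {g' a c : ℝ} (hg : HasDerivAt g g' a) (ha : 0 < a)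
    (hga : 0 < g a) (hc : a * g' / g a < c) :
    ∀ᶠ t in 𝓝[≤] a, (t / a) ^ c ≤ g t / g a := by
  have hpos : 0 < -(g' / g a - c * a⁻¹) := by
    have : g' / g a < c / a := by rwa [lt_div_iff₀ ha, div_mul_eq_mul_div, mul_comm g']
    rw [← div_eq_mul_inv]; linarith
  have h1 := eventually_le_of_hasDerivAt_pos (hasDerivAt_log_sub hg ha hga c).neg hpos
  have h2 : ∀ᶠ t in 𝓝[≤] a, 0 < t := nhdsWithin_le_nhds (lt_mem_nhds ha)
  have h3 : ∀ᶠ t in 𝓝[≤] a, 0 < g t :=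
    nhdsWithin_le_nhds (hg.continuousAt.eventually (lt_mem_nhds hga))
  filter_upwards [h1, h2, h3] with t h1 h2 h3
  simp only [Pi.neg_apply] at h1
  rw [← log_le_log_iff (by positivity) (by positivity), log_rpow (by positivity),
    log_div h3.ne' hga.ne', log_div h2.ne' ha.ne']
  linarith

/-- Moments are known only for integer exponents, so real powers are rounded; on `(0, 1]` a larger
exponent gives a smaller power. -/
theorem pow_ceil_le_rpow_pow {x c : ℝ} (hx : 0 < x) (hx1 : x ≤ 1) (n : ℕ) :
    x ^ ⌈c * n⌉₊ ≤ (x ^ c) ^ n := by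
  rw [← rpow_natCast (x ^ c), ← rpow_mul hx.le, ← rpow_natCast x]
  exact rpow_le_rpow_of_exponent_ge hx hx1 (Nat.le_ceil _)

theorem rpow_pow_le_pow_floor {x c : ℝ} (hx : 0 < x) (hx1 : x ≤ 1) (hc : 0 ≤ c) (n : ℕ) :
    (x ^ c) ^ n ≤ x ^ ⌊c * n⌋₊ := by
  rw [← rpow_natCast (x ^ c), ← rpow_mul hx.le, ← rpow_natCast x]
  exact rpow_le_rpow_of_exponent_ge hx hx1 (Nat.floor_le (by positivity))


/-! ### Comparing the kernel with powers of `t / 16` -/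

theorem exists_hasDerivAt_dominantRoot :
    ∃ D : ℝ, 0 < D ∧ HasDerivAt dominantRoot D 16 := by
  have h : HasDerivAt (fun t : ℝ => t ^ 2 - 4 * t) (2 * 16 - 4) 16 := by
    exact ((hasDerivAt_pow 2 (16 : ℝ)).sub ((hasDerivAt_id (16 : ℝ)).const_mul 4)).congr_deriv
      (by norm_num)
  have h' := ((hasDerivAt_id (16 : ℝ)).add (h.sqrt (by norm_num))).div_const 2
  exact ⟨_, by norm_num; positivity, h'⟩

theorem dominantAmplitude_sixteen_pos : 0 < dominantAmplitude 16 := by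
  have := two_le_dominantRoot (t := 16) (by norm_num)
  exact div_pos (by linarith) (sqrt_pos.2 (by norm_num))

theorem continuousAt_dominantAmplitude : ContinuousAt dominantAmplitude 16 := by
  unfold dominantAmplitude dominantRoot
  refine ContinuousAt.div (by fun_prop) (by fun_prop) ?_
  exact (sqrt_pos.2 (by norm_num)).ne'

/-- On `[0, 16]` the normalized kernel is squeezed between powers of `t / 16`, up to an
exponentially small error. -/
theorem exists_sieveKernel_squeeze {D κ K δ : ℝ} (hD : HasDerivAt dominantRoot D 16)
    (hκ : κ = 16 * D / dominantRoot 16) (hK : K = dominantAmplitude 16) (hδ : 0 < δ)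
    (hδκ : δ < κ) (hδK : δ < K) :
    ∃ r : ℝ, 0 ≤ r ∧ r < 1 ∧ ∀ (n : ℕ), ∀ t ∈ Set.Icc (0 : ℝ) 16,
      (K - δ) * (t / 16) ^ ⌈(κ + δ) * n⌉₊ - (1 + 2 * n + K) * r ^ n ≤
          sieveKernel t n / dominantRoot 16 ^ n ∧
        sieveKernel t n / dominantRoot 16 ^ n ≤
          (K + δ) * (t / 16) ^ ⌊(κ - δ) * n⌋₊ + (1 + 2 * n + K) * r ^ n := by
  have hμ : 0 < dominantRoot 16 := dominantRoot_pos (by norm_num)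
  have hev : ∀ᶠ t in 𝓝[≤] (16 : ℝ), (5 ≤ t ∧ K - δ ≤ dominantAmplitude t ∧
      dominantAmplitude t ≤ K + δ) ∧ dominantRoot t / dominantRoot 16 ≤ (t / 16) ^ (κ - δ) ∧
      (t / 16) ^ (κ + δ) ≤ dominantRoot t / dominantRoot 16 := by
    have hc := continuousAt_dominantAmplitude
    refine .and (.filter_mono nhdsWithin_le_nhds (.and (eventually_ge_nhds (by norm_num)) (.and ?_ ?_)))
      (.and (eventually_div_le_rpow hD (by norm_num) hμ (by linarith))
        (eventually_rpow_le_div hD (by norm_num) hμ (by linarith)))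
    · exact hc.eventually (eventually_ge_nhds (by linarith))
    · exact hc.eventually (eventually_le_nhds (by linarith))
  obtain ⟨t₀, ht₀, hsub⟩ := mem_nhdsLE_iff_exists_Icc_subset.1 hev
  have ht₀' : t₀ < 16 := ht₀
  have hprop : ∀ t, t₀ ≤ t → t ≤ 16 → _ := fun t h h' => hsub ⟨h, h'⟩
  simp only [Set.mem_ofPred_eq] at hprop
  obtain ⟨⟨h5, -, -⟩, -, hρ⟩ := hprop t₀ le_rfl ht₀'.le
  have hρ2 := two_le_dominantRoot (t := t₀) (by linarith)
  set μ := dominantRoot 16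
  set ρ := dominantRoot t₀
  have hr0 : 0 ≤ ρ / μ := by positivity
  -- Below `t₀` the kernel is bounded through `ρ`; above `t₀` the smaller root contributes at most
  -- `2 ^ n ≤ ρ ^ n`. One ratio serves both.
  refine ⟨ρ / μ, hr0, (div_lt_one hμ).2 (dominantRoot_lt (by linarith) ht₀'), ?_⟩
  rintro n t ⟨ht0, ht16⟩
  have hμn : 0 < μ ^ n := by positivity
  have hrn : 0 ≤ (ρ / μ) ^ n := by positivity
  have hK0 : 0 < K := hδ.trans hδK
  have hx0 : 0 ≤ t / 16 := by positivity
  have hx1 : t / 16 ≤ 1 := by linarith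
  rcases lt_or_ge t t₀ with hlt | hge
  · have hf : |sieveKernel t n / μ ^ n| ≤ (1 + 2 * n) * (ρ / μ) ^ n := by
      rw [abs_div, abs_of_pos hμn, div_pow, ← mul_div_assoc]
      gcongr
      exact abs_sieveKernel_le (by linarith) ht0 hlt.le n
    obtain ⟨hf1, hf2⟩ := abs_le.1 hf
    have hKr : 0 ≤ K * (ρ / μ) ^ n := by positivity
    constructor
    -- Left of `t₀` the main term of the lower bound is itself negligible; this accounts for the `K`
    -- in the error coefficient.
    · have h1 : (t / 16) ^ ⌈(κ + δ) * n⌉₊ ≤ (ρ / μ) ^ n :=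
        calc (t / 16) ^ ⌈(κ + δ) * n⌉₊ ≤ (t₀ / 16) ^ ⌈(κ + δ) * n⌉₊ := by gcongr
          _ ≤ ((t₀ / 16) ^ (κ + δ)) ^ n :=
            pow_ceil_le_rpow_pow (by linarith) (by linarith) n
          _ ≤ (ρ / μ) ^ n := by
            have : 0 ≤ t₀ / 16 := by linarith
            gcongr
      have h2 : (K - δ) * (t / 16) ^ ⌈(κ + δ) * n⌉₊ ≤ K * (ρ / μ) ^ n := by
        gcongr; linarith
      linarith
    · have : 0 ≤ (K + δ) * (t / 16) ^ ⌊(κ - δ) * n⌋₊ := by positivity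
      linarith
  · obtain ⟨⟨ht5, hA1, hA2⟩, hup, hlow⟩ := hprop t hge ht16
    have hx : 0 < t / 16 := by linarith
    have herr : |sieveKernel t n / μ ^ n - dominantAmplitude t * (dominantRoot t / μ) ^ n| ≤
        (1 + 2 * n + K) * (ρ / μ) ^ n := by
      have e : sieveKernel t n / μ ^ n - dominantAmplitude t * (dominantRoot t / μ) ^ n =
          (sieveKernel t n - dominantAmplitude t * dominantRoot t ^ n) / μ ^ n := by
        rw [div_pow]; ring
      rw [e, abs_div, abs_of_pos hμn]
      calc _ ≤ 2 ^ n / μ ^ n := by gcongr; exact abs_sieveKernel_sub_le ht5 n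
        _ ≤ ρ ^ n / μ ^ n := by gcongr
        _ = 1 * (ρ / μ) ^ n := by rw [div_pow, one_mul]
        _ ≤ _ := by
          gcongr
          have : (0 : ℝ) ≤ n := n.cast_nonneg
          linarith
    obtain ⟨h1, h2⟩ := abs_le.1 herr
    have hq0 : 0 ≤ dominantRoot t / μ := (div_pos (dominantRoot_pos (by linarith)) hμ).le
    constructor
    · have h3 : (K - δ) * (t / 16) ^ ⌈(κ + δ) * n⌉₊ ≤
          dominantAmplitude t * (dominantRoot t / μ) ^ n := by
        have h4 : (t / 16) ^ ⌈(κ + δ) * n⌉₊ ≤ (dominantRoot t / μ) ^ n :=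
          (pow_ceil_le_rpow_pow hx hx1 n).trans (by gcongr)
        have : 0 ≤ dominantAmplitude t := by linarith
        gcongr
      linarith
    · have h3 : dominantAmplitude t * (dominantRoot t / μ) ^ n ≤
          (K + δ) * (t / 16) ^ ⌊(κ - δ) * n⌋₊ := by
        have h4 : (dominantRoot t / μ) ^ n ≤ (t / 16) ^ ⌊(κ - δ) * n⌋₊ :=
          le_trans (by gcongr) (rpow_pow_le_pow_floor hx hx1 (by linarith) n)
        gcongr
      linarith

/-! ### The asymptotics -/

/-- Substituting k = `N n` ~ y n in q(k) ~ B/k³ divides the constant by y³. -/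
theorem tendsto_cube_mul_comp {q : ℕ → ℝ} {B y : ℝ} {N : ℕ → ℕ}
    (hq : Tendsto (fun k : ℕ => (k : ℝ) ^ 3 * q k) atTop (𝓝 B)) (hy : 0 < y)
    (hN : Tendsto (fun n : ℕ => (N n : ℝ) / n) atTop (𝓝 y)) :
    Tendsto (fun n : ℕ => (n : ℝ) ^ 3 * q (N n)) atTop (𝓝 (B / y ^ 3)) := by
  have hNtop : Tendsto N atTop atTop := by
    rw [← tendsto_natCast_atTop_iff (R := ℝ)]
    refine (hN.pos_mul_atTop hy tendsto_natCast_atTop_atTop).congr' ?_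
    filter_upwards [eventually_gt_atTop 0] with n hn
    have : (n : ℝ) ≠ 0 := by positivity
    field_simp
  refine ((hq.comp hNtop).div (hN.pow 3) (by positivity)).congr' ?_
  filter_upwards [eventually_gt_atTop 0, hNtop.eventually_gt_atTop 0] with n hn hNn
  have h1 : (n : ℝ) ≠ 0 := by positivity
  have h2 : (N n : ℝ) ≠ 0 := by positivity
  simp only [Pi.div_apply, Function.comp_apply]
  field_simp

theorem tendsto_cube_mul_affine_mul_pow {r : ℝ} (hr0 : 0 ≤ r) (hr1 : r < 1) (K : ℝ) :
    Tendsto (fun n : ℕ => (n : ℝ) ^ 3 * ((1 + 2 * n + K) * r ^ n)) atTop (𝓝 0) := by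
  have h3 := (tendsto_pow_const_mul_const_pow_of_lt_one 3 hr0 hr1).const_mul (1 + K)
  have h4 := (tendsto_pow_const_mul_const_pow_of_lt_one 4 hr0 hr1).const_mul 2
  have := h3.add h4
  simp only [mul_zero, add_zero] at this
  refine this.congr fun n => ?_
  ring

theorem tendsto_numReducedTreePairs {D κ K : ℝ} (hD0 : 0 < D)
    (hD : HasDerivAt dominantRoot D 16) (hκ : κ = 16 * D / dominantRoot 16)
    (hK : K = dominantAmplitude 16) :
    Tendsto (fun n : ℕ => (n : ℝ) ^ 3 * ((numReducedTreePairs n : ℝ) / dominantRoot 16 ^ n)) atTop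
      (𝓝 (K * (1 / π / κ ^ 3))) := by
  obtain ⟨ν, hν, hsupp, hmom⟩ := exists_measure_moments_catalan_sq
  have hμ : 0 < dominantRoot 16 := dominantRoot_pos (by norm_num)
  have hκ0 : 0 < κ := by rw [hκ]; positivity
  have hK0 : 0 < K := hK ▸ dominantAmplitude_sixteen_pos
  have hq : ∀ k : ℕ, ∫ t, (t / 16) ^ k ∂ν = (catalan k : ℝ) ^ 2 / 16 ^ k := fun k => by
    simp_rw [div_pow]
    rw [integral_div, hmom]
  have hint : ∀ (c e : ℝ) (k : ℕ), ∫ t, (c * (t / 16) ^ k + e) ∂ν =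
      c * ((catalan k : ℝ) ^ 2 / 16 ^ k) + e := fun c e k => by
    rw [integral_add (integrable_of_continuous_of_ae_mem_Icc hsupp (by fun_prop))
      (integrable_const _), integral_const_mul, hq]
    simp
  have hr : ∀ n : ℕ, 2 ≤ n → (numReducedTreePairs n : ℝ) / dominantRoot 16 ^ n =
      ∫ t, sieveKernel t n / dominantRoot 16 ^ n ∂ν := fun n hn => by
    rw [integral_div, numReducedTreePairs_eq_integral hsupp hmom hn]
  have hI : ∀ n, Integrable (fun t => sieveKernel t n / dominantRoot 16 ^ n) ν := fun n =>
    integrable_of_continuous_of_ae_mem_Icc hsupp ((continuous_sieveKernel n).div_const _)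
  have hJ : ∀ (c e : ℝ) (k : ℕ), Integrable (fun t => c * (t / 16) ^ k + e) ν := fun c e k =>
    integrable_of_continuous_of_ae_mem_Icc hsupp (by fun_prop)
  have hsmall : ∀ᶠ δ in 𝓝[>] (0 : ℝ), 0 < δ ∧ δ < κ ∧ δ < K :=
    .and self_mem_nhdsWithin (.filter_mono nhdsWithin_le_nhds
      (.and (gt_mem_nhds hκ0) (gt_mem_nhds hK0)))
  -- Each one-sided limit constant is continuous in `δ` at `0`, so a small `δ > 0` already separates
  -- it from `a`.
  refine tendsto_order.2 ⟨fun a ha => ?_, fun a ha => ?_⟩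
  · have hcont : ContinuousAt (fun δ : ℝ => (K - δ) * (1 / π / (κ + δ) ^ 3)) 0 := by
      refine ContinuousAt.mul (by fun_prop) (ContinuousAt.div (by fun_prop) (by fun_prop) ?_)
      simp [hκ0.ne']
    have hδev : ∀ᶠ δ in 𝓝[>] (0 : ℝ), a < (K - δ) * (1 / π / (κ + δ) ^ 3) :=
      nhdsWithin_le_nhds (hcont.eventually (lt_mem_nhds (by simpa using ha)))
    obtain ⟨δ, hδa, hδ, hδκ, hδK⟩ := (hδev.and hsmall).exists
    obtain ⟨r, hr0, hr1, hsq⟩ := exists_sieveKernel_squeeze hD hκ hK hδ hδκ hδK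
    have hN : Tendsto (fun n : ℕ => (⌈(κ + δ) * n⌉₊ : ℝ) / n) atTop (𝓝 (κ + δ)) :=
      (tendsto_nat_ceil_mul_div_atTop (by linarith)).comp tendsto_natCast_atTop_atTop
    have hlim := ((tendsto_cube_mul_comp tendsto_catalan_sq (by linarith) hN).const_mul (K - δ)).sub
      (tendsto_cube_mul_affine_mul_pow hr0 hr1 K)
    rw [sub_zero] at hlim
    filter_upwards [hlim.eventually (lt_mem_nhds hδa), eventually_ge_atTop 2] with n hn hn2
    refine hn.trans_le ?_
    rw [hr n hn2]
    have := integral_mono_ae (hJ (K - δ) (-((1 + 2 * n + K) * r ^ n)) ⌈(κ + δ) * n⌉₊) (hI n)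
      (hsupp.mono fun t ht => by simpa [sub_eq_add_neg] using (hsq n t ht).1)
    rw [hint] at this
    have h3 : (0 : ℝ) ≤ (n : ℝ) ^ 3 := by positivity
    linarith [mul_le_mul_of_nonneg_left this h3]
  · have hcont : ContinuousAt (fun δ : ℝ => (K + δ) * (1 / π / (κ - δ) ^ 3)) 0 := by
      refine ContinuousAt.mul (by fun_prop) (ContinuousAt.div (by fun_prop) (by fun_prop) ?_)
      simp [hκ0.ne']
    have hδev : ∀ᶠ δ in 𝓝[>] (0 : ℝ), (K + δ) * (1 / π / (κ - δ) ^ 3) < a :=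
      nhdsWithin_le_nhds (hcont.eventually (gt_mem_nhds (by simpa using ha)))
    obtain ⟨δ, hδa, hδ, hδκ, hδK⟩ := (hδev.and hsmall).exists
    obtain ⟨r, hr0, hr1, hsq⟩ := exists_sieveKernel_squeeze hD hκ hK hδ hδκ hδK
    have hN : Tendsto (fun n : ℕ => (⌊(κ - δ) * n⌋₊ : ℝ) / n) atTop (𝓝 (κ - δ)) :=
      (tendsto_nat_floor_mul_div_atTop (by linarith)).comp tendsto_natCast_atTop_atTop
    have hlim := ((tendsto_cube_mul_comp tendsto_catalan_sq (by linarith) hN).const_mul (K + δ)).add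
      (tendsto_cube_mul_affine_mul_pow hr0 hr1 K)
    rw [add_zero] at hlim
    filter_upwards [hlim.eventually (gt_mem_nhds hδa), eventually_ge_atTop 2] with n hn hn2
    refine lt_of_le_of_lt ?_ hn
    rw [hr n hn2]
    have := integral_mono_ae (hI n) (hJ (K + δ) ((1 + 2 * n + K) * r ^ n) ⌊(κ - δ) * n⌋₊)
      (hsupp.mono fun t ht => (hsq n t ht).2)
    rw [hint] at this
    have h3 : (0 : ℝ) ≤ (n : ℝ) ^ 3 := by positivity
    linarith [mul_le_mul_of_nonneg_left this h3]

theorem mainTheorem1 :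
    ∃ A : ℝ, 0 < A ∧
      Filter.Tendsto
        (fun n : ℕ => (numReducedTreePairs n : ℝ) / (A * (8 + 4 * √3) ^ n / (n : ℝ) ^ 3))
        Filter.atTop (nhds 1) := by
  obtain ⟨D, hD0, hD⟩ := exists_hasDerivAt_dominantRoot
  have hμ : 0 < dominantRoot 16 := dominantRoot_pos (by norm_num)
  have hK := dominantAmplitude_sixteen_pos
  have hlim := tendsto_numReducedTreePairs hD0 hD rfl rfl
  set A := dominantAmplitude 16 * (1 / π / (16 * D / dominantRoot 16) ^ 3) with hA
  have hA0 : 0 < A := by have := pi_pos; positivity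
  refine ⟨A, hA0, ?_⟩
  rw [← dominantRoot_sixteen]
  have h := hlim.div_const A
  rw [div_self hA0.ne'] at h
  refine h.congr fun n => ?_
  rw [div_div_eq_mul_div]
  clear_value A
  ring
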